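/- Consider mixed integer programs $\max\{cx+hy : Ax+Gy\le b,\ x\in\mathbb Z^p,\ y\in\mathbb R^q\}$ with rational data $A,G,b,c,h$. Let $P=\{(x,y)\in\mathbb R^{p+q}: Ax+Gy\le b\}$, and for a set $C\subseteq\mathbb R^{p+q}$ let $C_I=\mathrm{conv}\{(x,y)\in C: x\in\mathbb Z^p\}$. For $k\ge 2$, a $k$-disjunction consists of $d^1,\dots,d^k\in\mathbb Z^p$ and $\delta^1,\dots,\delta^k\in\mathbb Z$ such that every $x\in\mathbb Z^p$ satisfies $d^ix\le\delta^i$ for at least one $i$. An inequality $\alpha x+\beta y\le\gamma$ with $\alpha\in\mathbb Q^p$, $\beta\in\mathbb Q^q$, $\gamma\in\mathbb R$ is a $k$-disjunctive cut for $C$ if it is valid for $C_I$ but not for $C$, and there is a $k$-disjunction such that every $(x,y)\in C$ with $\alpha x+\beta y>\gamma$ satisfies $d^ix>\delta^i$ for all $i=1,\dots,k$. The $k$-disjunctive closure of $C$ is the set of points of $C$ that satisfy all $k$-disjunctive cuts for $C$. Put $P_k^{(0)}=P$ and let $P_k^{(n+1)}$ be the $k$-disjunctive closure of $P_k^{(n)}$.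 Theorem. For all integers $p\ge 3$ and $q\ge 1$ there is such a mixed integer program, with $cx+hy$ bounded above on $P$, for which $\gamma^*:=\max\{cx+hy:(x,y)\in P_I\}$ exists and for every $n\in\mathbb N$ the maximum of $cx+hy$ over $P^{(n)}_{2^{p-1}+1}$ exists and satisfies $$\max\{cx+hy:(x,y)\in P^{(n)}_{2^{p-1}+1}\}>\gamma^*.$$ -/

import Mathlib

namespace MILP

/-- Points `(x, y)` of `ℝ^(p+q)`: `x` are the integer variables, `y` the continuous ones. -/
abbrev Point (p q : ℕ) : Type := (Fin p → ℝ) × (Fin q → ℝ)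

/-- The linear function `(x, y) ↦ α x + β y` with rational coefficients. -/
def linVal {p q : ℕ} (α : Fin p → ℚ) (β : Fin q → ℚ) (z : Point p q) : ℝ :=
  ∑ i, (α i : ℝ) * z.1 i + ∑ j, (β j : ℝ) * z.2 j

/-- The rational polyhedron `{(x, y) : A x + G y ≤ b}`. -/
def polyhedron {p q m : ℕ} (A : Matrix (Fin m) (Fin p) ℚ) (G : Matrix (Fin m) (Fin q) ℚ)
    (b : Fin m → ℚ) : Set (Point p q) :=
  {z | ∀ r, linVal (A r) (G r) z ≤ (b r : ℝ)}

/-- The mixed integer hull `conv {(x, y) ∈ P : x ∈ ℤ^p}`. -/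
def integerHull {p q : ℕ} (P : Set (Point p q)) : Set (Point p q) :=
  convexHull ℝ {z | z ∈ P ∧ ∃ u : Fin p → ℤ, ∀ i, z.1 i = (u i : ℝ)}

/-- The inequalities `d i x ≤ δ i`, `i = 1, …, k`, form a `k`-disjunction:
`k ≥ 2` and every integral vector satisfies at least one of them. -/
def IsDisjunction {p : ℕ} (k : ℕ) (d : Fin k → Fin p → ℤ) (δ : Fin k → ℤ) : Prop :=
  2 ≤ k ∧ ∀ u : Fin p → ℤ, ∃ i, ∑ j, d i j * u j ≤ δ i

/-- `α x + β y ≤ γ` is a cutting plane for `P`: valid for the mixed integer hull, not for `P`. -/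
def IsCuttingPlane {p q : ℕ} (P : Set (Point p q)) (α : Fin p → ℚ) (β : Fin q → ℚ) (γ : ℝ) :
    Prop :=
  (∀ z ∈ integerHull P, linVal α β z ≤ γ) ∧ ¬ ∀ z ∈ P, linVal α β z ≤ γ

/-- `α x + β y ≤ γ` is a `k`-disjunctive cut for `P`: a cutting plane such that, for some
`k`-disjunction, every point of `P` that is cut off violates all `k` terms. -/
def IsDisjunctiveCut {p q : ℕ} (k : ℕ) (P : Set (Point p q)) (α : Fin p → ℚ) (β : Fin q → ℚ)
    (γ : ℝ) : Prop :=
  IsCuttingPlane P α β γ ∧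
    ∃ (d : Fin k → Fin p → ℤ) (δ : Fin k → ℤ), IsDisjunction k d δ ∧
      ∀ z ∈ P, γ < linVal α β z → ∀ i, (δ i : ℝ) < ∑ j, (d i j : ℝ) * z.1 j

/-- The `k`-disjunctive closure: the points of `P` that satisfy all `k`-disjunctive cuts. -/
def disjClosure {p q : ℕ} (k : ℕ) (P : Set (Point p q)) : Set (Point p q) :=
  {z | z ∈ P ∧ ∀ α β γ, IsDisjunctiveCut k P α β γ → linVal α β z ≤ γ}

/-- The `n`-th `k`-disjunctive closure `P_k^(n)`, starting from `P_k^(0) = P`. -/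
def iterClosure {p q : ℕ} (k : ℕ) (P : Set (Point p q)) : ℕ → Set (Point p q)
  | 0 => P
  | n + 1 => disjClosure k (iterClosure k P n)

end MILP

namespace MILP

open Finset

/-! Write `p = r + 3`, so there are `k = 2^(r+2) + 1` terms. The objective is the sum of the `y j`,
and `P` is a pyramid over `body r`. The slices of the body are weighted cross-polytopes whose centre
moves from the all-ones vector at `x 0 = -1` to `0` at `x 0 = 1`. The weights have integral
reciprocals, so the two end facets have integral vertices and the body lies in the hull; they add up
to `2`, so the slice `x 0 = 0` has the 0/1 vectors on its boundary and no integral point inside.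
Hence the objective is at most `0` on `P_I`.

The 0/1 vectors and the two facet centres are `k + 1` integral points with pairwise midpoints
interior to the body (`mid_mem`). For every `k`-disjunction two of them satisfy the same term, hence
so does their midpoint (`exists_node_pair`), and no cut removes the points of the closure above it.
Averaging such a point with the reflected midpoint in the hull gives a point of positive height
above the centre (`center_mem_disjClosure`). The hull never changes, so this repeats forever. -/

/-- Weights of the cross-polytope norm; they add up to `2`. -/
def wt (r : ℕ) : Fin (r + 2) → ℚ := Fin.cons 1 fun _ => 1 / ((r : ℚ) + 1)

/-- Weighted `ℓ¹`-distance of `(x₁, x₂, …)` from the centre of the slice at height `x₀`. -/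
noncomputable def dev {r : ℕ} (x : Fin (r + 3) → ℝ) : ℝ :=
  ∑ i : Fin (r + 2), (wt r i : ℝ) * |x i.succ - (1 - x 0) / 2|

/-- An integral polytope without integral points in its interior. -/
def body (r : ℕ) : Set (Fin (r + 3) → ℝ) := {x | |x 0| ≤ 1 ∧ dev x ≤ 1}

/-- The centre of symmetry of `body r`. -/
noncomputable def center (r : ℕ) : Fin (r + 3) → ℝ := Fin.cons 0 fun _ => 1 / 2

/-- The pyramid over `body r`. -/
def pyramid (r q : ℕ) : Set (Point (r + 3) q) :=
  {z | (∀ j, 0 ≤ z.2 j) ∧ |z.1 0| + ∑ j, z.2 j ≤ 1 ∧ dev z.1 + ∑ j, z.2 j ≤ 1}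

lemma wt_pos (r : ℕ) (i : Fin (r + 2)) : (0 : ℝ) < (wt r i : ℝ) := by
  refine Fin.cases ?_ (fun i => ?_) i <;> simp only [wt, Fin.cons_zero, Fin.cons_succ]
  · norm_num
  · push_cast; positivity

lemma le_wt (r : ℕ) (i : Fin (r + 2)) : 1 / ((r : ℝ) + 1) ≤ (wt r i : ℝ) := by
  refine Fin.cases ?_ (fun i => ?_) i <;> simp only [wt, Fin.cons_zero, Fin.cons_succ]
  · rw [div_le_iff₀ (by positivity)]; push_cast; linarith [(Nat.cast_nonneg r : (0 : ℝ) ≤ r)]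
  · push_cast; exact le_rfl

lemma sum_wt (r : ℕ) : ∑ i, (wt r i : ℝ) = 2 := by
  have : (r : ℝ) + 1 ≠ 0 := by positivity
  rw [Fin.sum_univ_succ]
  simp [wt]
  field_simp
  norm_num

/-! ### The pyramid is a rational polyhedron -/

/-- The sign encoded by a Boolean. -/
def sgn (b : Bool) : ℚ := if b then 1 else -1

lemma sgn_mul_le_abs (b : Bool) (a : ℝ) : (sgn b : ℝ) * a ≤ |a| := by
  cases b
  · simpa [sgn] using neg_le_abs a
  · simpa [sgn] using le_abs_self a

lemma forall_sum_sgn_le_iff {n : ℕ} (w : Fin n → ℝ) (hw : ∀ i, 0 < w i) (e : Fin n → ℝ) (c : ℝ) :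
    (∀ s : Fin n → Bool, ∑ i, (sgn (s i) : ℝ) * w i * e i ≤ c) ↔ ∑ i, w i * |e i| ≤ c := by
  constructor
  · intro h
    refine le_trans (le_of_eq ?_) (h fun i => decide (0 ≤ e i))
    refine sum_congr rfl fun i _ => ?_
    by_cases hi : 0 ≤ e i
    · simp [sgn, hi, abs_of_nonneg hi]
    · simp [sgn, hi, abs_of_neg (not_le.mp hi)]
  · intro h s
    refine le_trans (sum_le_sum fun i _ => ?_) h
    have := mul_le_mul_of_nonneg_left (sgn_mul_le_abs (s i) (e i)) (hw i).le
    linarith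

lemma linVal_cons {r q : ℕ} (a : ℚ) (f : Fin (r + 2) → ℚ) (β : Fin q → ℚ)
    (z : Point (r + 3) q) :
    linVal (Fin.cons a f : Fin (r + 3) → ℚ) β z =
      (a : ℝ) * z.1 0 + ∑ i, (f i : ℝ) * z.1 i.succ + ∑ j, (β j : ℝ) * z.2 j := by
  simp [linVal, Fin.sum_univ_succ (n := r + 2)]

lemma linVal_zero_one {p q : ℕ} (z : Point p q) : linVal 0 1 z = ∑ j, z.2 j := by
  simp [linVal]

/-- Each absolute value is replaced by all choices of sign; the halved sums of signed weights come
from expanding the slice centre `(1 - x 0) / 2`. -/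
theorem exists_polyhedron_eq_pyramid (r q : ℕ) :
    ∃ (m : ℕ) (A : Matrix (Fin m) (Fin (r + 3)) ℚ) (G : Matrix (Fin m) (Fin q) ℚ)
      (b : Fin m → ℚ), polyhedron A G b = pyramid r q := by
  classical
  let ι := Fin q ⊕ (Bool ⊕ (Fin (r + 2) → Bool))
  let e : ι ≃ Fin (Fintype.card ι) := Fintype.equivFin ι
  let A : ι → Fin (r + 3) → ℚ := Sum.elim (fun _ => 0) (Sum.elim
    (fun s => Fin.cons (sgn s) fun _ => 0)
    (fun s => Fin.cons (∑ i, sgn (s i) * wt r i / 2) fun i => sgn (s i) * wt r i))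
  let G : ι → Fin q → ℚ := Sum.elim (fun j => -Pi.single j 1) (fun _ => 1)
  let b : ι → ℚ := Sum.elim (fun _ => 0) (Sum.elim (fun _ => 1)
    (fun s => 1 + ∑ i, sgn (s i) * wt r i / 2))
  refine ⟨Fintype.card ι, fun k => A (e.symm k), fun k => G (e.symm k), fun k => b (e.symm k), ?_⟩
  ext z
  have h1 : z ∈ polyhedron (fun k => A (e.symm k)) (fun k => G (e.symm k))
      (fun k => b (e.symm k)) ↔ ∀ i : ι, linVal (A i) (G i) z ≤ (b i : ℝ) := by
    constructor
    · intro h i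
      simpa using h (e i)
    · intro h k
      exact h _
  rw [h1]
  simp only [ι, Sum.forall]
  refine and_congr (forall_congr' fun j => ?_) (and_congr ?_ ?_)
  · simp [A, G, b, linVal, Pi.single_apply, apply_ite]
  · simp only [A, G, b, Sum.elim_inl, Sum.elim_inr, linVal_cons, Bool.forall_bool, sgn]
    simp only [Rat.cast_zero, zero_mul, sum_const_zero, Pi.one_apply, Rat.cast_one, one_mul]
    rw [← le_sub_iff_add_le (a := |z.1 0|), abs_le]
    constructor
    · rintro ⟨h, h'⟩
      push_cast at h h'
      constructor <;> simp at h h' <;> linarith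
    · rintro ⟨h, h'⟩
      constructor <;> simp <;> linarith
  · rw [← le_sub_iff_add_le, dev, ← forall_sum_sgn_le_iff _ (wt_pos r)]
    refine forall_congr' fun s => ?_
    simp only [A, G, b, Sum.elim_inr, linVal_cons, Pi.one_apply, Rat.cast_one, one_mul]
    push_cast
    have : ∑ i, (sgn (s i) : ℝ) * (wt r i : ℝ) * (z.1 i.succ - (1 - z.1 0) / 2) =
        (∑ i, (sgn (s i) : ℝ) * (wt r i : ℝ) / 2) * z.1 0
        + ∑ i, (sgn (s i) : ℝ) * (wt r i : ℝ) * z.1 i.succ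
        - ∑ i, (sgn (s i) : ℝ) * (wt r i : ℝ) / 2 := by
      rw [sum_mul, ← sum_add_distrib, ← sum_sub_distrib]
      exact sum_congr rfl fun i _ => by ring
    rw [this]
    constructor <;> intro h <;> linarith

/-! ### Geometry of the body and the pyramid -/

lemma abs_le_of_mem_pyramid {r q : ℕ} {z : Point (r + 3) q} (hz : z ∈ pyramid r q) :
    (∀ i, |z.1 i| ≤ r + 2) ∧ ∀ j, |z.2 j| ≤ 1 := by
  obtain ⟨h0, h1, h2⟩ := hz
  have hr : (0 : ℝ) ≤ r := Nat.cast_nonneg r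
  have hs : 0 ≤ ∑ j, z.2 j := sum_nonneg fun j _ => h0 j
  have hd : 0 ≤ dev z.1 := sum_nonneg fun i _ => mul_nonneg (wt_pos r i).le (abs_nonneg _)
  refine ⟨fun i => ?_, fun j => ?_⟩
  · refine Fin.cases (by linarith) (fun i => ?_) i
    have h3 : (wt r i : ℝ) * |z.1 i.succ - (1 - z.1 0) / 2| ≤ dev z.1 :=
      single_le_sum (f := fun i : Fin (r + 2) => (wt r i : ℝ) * |z.1 i.succ - (1 - z.1 0) / 2|)
        (fun i _ => mul_nonneg (wt_pos r i).le (abs_nonneg _)) (mem_univ i)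
    have h4 := mul_le_mul_of_nonneg_right (le_wt r i) (abs_nonneg (z.1 i.succ - (1 - z.1 0) / 2))
    -- So `x i.succ` is within `r + 1` of the slice centre, which lies in `[0, 1]`.
    have h5 : 1 / ((r : ℝ) + 1) * |z.1 i.succ - (1 - z.1 0) / 2| ≤ 1 := by linarith
    rw [one_div_mul_eq_div, div_le_one (by positivity)] at h5
    have h6 : |z.1 0| ≤ 1 := by linarith
    rw [abs_le] at h5 h6 ⊢
    constructor <;> linarith
  · rw [abs_of_nonneg (h0 j)]
    have := single_le_sum (f := z.2) (fun j _ => h0 j) (mem_univ j)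
    linarith [abs_nonneg (z.1 0)]

lemma isClosed_pyramid (r q : ℕ) : IsClosed (pyramid r q) := by
  have h : Continuous fun z : Point (r + 3) q => dev z.1 := by unfold dev; fun_prop
  have h0 : IsClosed {z : Point (r + 3) q | ∀ j, 0 ≤ z.2 j} := by
    rw [Set.ofPred_forall]
    exact isClosed_iInter fun j => isClosed_le continuous_const (by fun_prop)
  have h1 : IsClosed {z : Point (r + 3) q | |z.1 0| + ∑ j, z.2 j ≤ 1} :=
    isClosed_le (by fun_prop) continuous_const
  have h2 : IsClosed {z : Point (r + 3) q | dev z.1 + ∑ j, z.2 j ≤ 1} :=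
    isClosed_le (by fun_prop) continuous_const
  exact h0.inter (h1.inter h2)

lemma isCompact_pyramid (r q : ℕ) : IsCompact (pyramid r q) := by
  refine IsCompact.of_isClosed_subset (isCompact_Icc
    (a := ((fun _ => -((r : ℝ) + 2), fun _ => -1) : Point (r + 3) q))
    (b := ((fun _ => (r : ℝ) + 2, fun _ => 1) : Point (r + 3) q))) (isClosed_pyramid r q) ?_
  intro z hz
  obtain ⟨h1, h2⟩ := abs_le_of_mem_pyramid hz
  exact ⟨⟨fun i => (abs_le.mp (h1 i)).1, fun j => (abs_le.mp (h2 j)).1⟩,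
    ⟨fun i => (abs_le.mp (h1 i)).2, fun j => (abs_le.mp (h2 j)).2⟩⟩

lemma mem_pyramid_of_mem_body {r : ℕ} (q : ℕ) {x : Fin (r + 3) → ℝ} (hx : x ∈ body r) :
    ((x, 0) : Point (r + 3) q) ∈ pyramid r q := by
  exact ⟨by simp, by simpa using hx.1, by simpa using hx.2⟩

/-- Every integer is at least `1/2` away from `1/2`, and the weights add up to `2`. -/
lemma one_le_dev_of_integral {r : ℕ} {x : Fin (r + 3) → ℝ} (u : Fin (r + 3) → ℤ)
    (hu : ∀ i, x i = (u i : ℝ)) (h0 : u 0 = 0) : 1 ≤ dev x := by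
  have : ∀ i : Fin (r + 2), (wt r i : ℝ) * (1 / 2) ≤ wt r i * |x i.succ - (1 - x 0) / 2| := by
    intro i
    refine mul_le_mul_of_nonneg_left ?_ (wt_pos r i).le
    rw [hu, hu, h0]
    rcases le_or_gt (u i.succ) 0 with h | h
    · have : (u i.succ : ℝ) ≤ 0 := by exact_mod_cast h
      rw [le_abs]; right; push_cast; linarith
    · have : (1 : ℝ) ≤ (u i.succ : ℝ) := by exact_mod_cast h
      rw [le_abs]; left; push_cast; linarith
  have h := sum_le_sum fun i (_ : i ∈ univ) => this i
  rw [← sum_mul, sum_wt] at h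
  unfold dev
  linarith

lemma sum_le_zero_of_integral {r q : ℕ} {z : Point (r + 3) q} (hz : z ∈ pyramid r q)
    (u : Fin (r + 3) → ℤ) (hu : ∀ i, z.1 i = (u i : ℝ)) : ∑ j, z.2 j ≤ 0 := by
  obtain ⟨-, h1, h2⟩ := hz
  by_cases h0 : u 0 = 0
  · linarith [one_le_dev_of_integral u hu h0]
  · have : (1 : ℝ) ≤ |z.1 0| := by
      rw [hu]
      exact_mod_cast Int.one_le_abs h0
    linarith

/-- The sum `∑ |d i| w i` being at most `1`, the vector `d` is a convex combination of `0` and the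
vectors `± (1 / w i) e i`. -/
lemma mem_of_weighted_sum_abs_le_one {n : ℕ} {w d : Fin n → ℝ} (hw : ∀ i, 0 < w i)
    (hd : ∑ i, w i * |d i| ≤ 1) {C : Set (Fin n → ℝ)} (hC : Convex ℝ C) (h0 : (0 : Fin n → ℝ) ∈ C)
    (hp : ∀ i, Pi.single i (1 / w i) ∈ C) (hm : ∀ i, Pi.single i (-(1 / w i)) ∈ C) : d ∈ C := by
  let v : Option (Fin n) → Fin n → ℝ := fun o => o.elim 0 fun i =>
    Pi.single i (if 0 ≤ d i then 1 / w i else -(1 / w i))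
  let c : Option (Fin n) → ℝ := fun o => o.elim (1 - ∑ i, w i * |d i|) fun i => w i * |d i|
  have hv : d = ∑ o, c o • v o := by
    rw [Fintype.sum_option]
    ext j
    simp only [v, c, Option.elim, smul_zero, zero_add, Finset.sum_apply, Pi.smul_apply, smul_eq_mul]
    rw [Finset.sum_eq_single j]
    · have := (hw j).ne'
      rw [Pi.single_eq_same]
      split_ifs with h
      · rw [abs_of_nonneg h]; field_simp
      · rw [abs_of_neg (not_le.mp h)]; field_simp
    · intro i _ hij
      rw [Pi.single_eq_of_ne hij.symm, mul_zero]
    · simp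
  rw [hv]
  refine hC.sum_mem (fun o _ => ?_) ?_ (fun o _ => ?_)
  · cases o with
    | none => simpa [c] using hd
    | some i => exact mul_nonneg (hw i).le (abs_nonneg _)
  · rw [Fintype.sum_option]; simp [c]
  · cases o with
    | none => exact h0
    | some i =>
      simp only [v, Option.elim]
      split_ifs
      · exact hp i
      · exact hm i

/-- The reciprocals of the weights are integers. -/
lemma exists_int_eq_one_div_wt (r : ℕ) (i : Fin (r + 2)) :
    ∃ m : ℤ, 1 / (wt r i : ℝ) = m := by
  refine Fin.cases ⟨1, by simp [wt]⟩ (fun i => ⟨r + 1, by simp [wt]⟩) i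

/-- The top (`s = 1`) and bottom (`s = -1`) facets of the body lie in the integer hull. -/
lemma cons_mem_integerHull {r : ℕ} (q : ℕ) (s : ℤ) (hs : |s| = 1) {d : Fin (r + 2) → ℝ}
    (hd : ∑ i, (wt r i : ℝ) * |d i| ≤ 1) :
    (((Fin.cons (s : ℝ) fun i => d i + (1 - s) / 2 : Fin (r + 3) → ℝ), 0) : Point (r + 3) q) ∈
      integerHull (pyramid r q) := by
  -- The centre of the facet is integral, so integral offsets `d` give integral points.
  obtain ⟨k, hk⟩ : ∃ k : ℤ, (1 - (s : ℝ)) / 2 = k := by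
    rcases (abs_eq zero_le_one).mp hs with rfl | rfl
    · exact ⟨0, by norm_num⟩
    · exact ⟨1, by norm_num⟩
  let F : (Fin (r + 2) → ℝ) → Point (r + 3) q := fun d =>
    ((Fin.cons (s : ℝ) fun i => d i + (1 - s) / 2 : Fin (r + 3) → ℝ), 0)
  have hF : Convex ℝ (F ⁻¹' integerHull (pyramid r q)) := by
    intro x hx y hy a b ha hb hab
    have hxy := (convex_convexHull ℝ _ : Convex ℝ (integerHull (pyramid r q))) hx hy ha hb hab
    have : F (a • x + b • y) = a • F x + b • F y := by
      refine Prod.ext ?_ (by simp [F])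
      funext i
      refine Fin.cases ?_ (fun i => ?_) i
      · simp [F, ← add_mul, hab]
      · simp only [F, Prod.fst_add, Prod.smul_fst, Pi.add_apply, Pi.smul_apply, Fin.cons_succ,
          smul_eq_mul]
        linear_combination (-(1 - (s : ℝ)) / 2) * hab
    rw [Set.mem_preimage, this]
    exact hxy
  have key : ∀ x : Fin (r + 2) → ℝ, (∀ i, ∃ m : ℤ, x i = m) → ∑ i, (wt r i : ℝ) * |x i| ≤ 1 →
      x ∈ F ⁻¹' integerHull (pyramid r q) := by
    intro x hx hx1
    choose m hm using hx
    refine subset_convexHull ℝ _ ⟨mem_pyramid_of_mem_body q ⟨?_, ?_⟩,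
      (Fin.cons s fun i => m i + k : Fin (r + 3) → ℤ), fun i => ?_⟩
    · have : |(s : ℝ)| = 1 := by exact_mod_cast hs
      simp [this]
    · simpa [dev] using hx1
    · refine Fin.cases ?_ (fun i => ?_) i
      · simp [F]
      · simp [F, hm, hk]
  have key' : ∀ (i : Fin (r + 2)) (a : ℝ), (∃ m : ℤ, a = m) → |a| = 1 / (wt r i : ℝ) →
      Pi.single i a ∈ F ⁻¹' integerHull (pyramid r q) := by
    rintro i a ⟨m, hm⟩ ha
    refine key _ (fun j => ?_) ?_
    · by_cases h : j = i
      · subst h; exact ⟨m, by simpa using hm⟩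
      · exact ⟨0, by simp [h]⟩
    · rw [Finset.sum_eq_single i]
      · rw [Pi.single_eq_same, ha, mul_one_div_cancel (wt_pos r i).ne']
      · intro j _ hj; simp [hj]
      · simp
  refine mem_of_weighted_sum_abs_le_one (wt_pos r) hd hF
    (key 0 (fun i => ⟨0, by simp⟩) (by simp)) (fun i => ?_) (fun i => ?_)
  · exact key' i _ (exists_int_eq_one_div_wt r i)
      (abs_of_pos (one_div_pos.mpr (wt_pos r i)))
  · obtain ⟨m, hm⟩ := exists_int_eq_one_div_wt r i
    exact key' i _ ⟨-m, by rw [hm]; push_cast; rfl⟩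
      (by rw [abs_neg]; exact abs_of_pos (one_div_pos.mpr (wt_pos r i)))

/-- The slice centre is affine in `x 0`, so a point lies on the segment between the points of the
end facets with the same offset from their centres. -/
theorem body_subset_integerHull {r : ℕ} (q : ℕ) {x : Fin (r + 3) → ℝ} (hx : x ∈ body r) :
    ((x, 0) : Point (r + 3) q) ∈ integerHull (pyramid r q) := by
  obtain ⟨h0, h1⟩ := hx
  rw [abs_le] at h0
  have hc := (convex_convexHull ℝ _ : Convex ℝ (integerHull (pyramid r q)))
    (cons_mem_integerHull q 1 (by norm_num) h1) (cons_mem_integerHull q (-1) (by norm_num) h1)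
    (a := (1 + x 0) / 2) (b := (1 - x 0) / 2) (by linarith) (by linarith) (by ring)
  refine (congrArg (· ∈ integerHull (pyramid r q)) ?_).mpr hc
  refine Prod.ext ?_ (by simp)
  funext i
  refine Fin.cases ?_ (fun i => ?_) i
  · simp; ring
  · simp; ring

lemma reflect_mem_body {r : ℕ} {x : Fin (r + 3) → ℝ} (hx : x ∈ body r) :
    (2 : ℝ) • center r - x ∈ body r := by
  refine ⟨by simpa [center] using hx.1, le_trans (le_of_eq ?_) hx.2⟩
  refine sum_congr rfl fun i _ => ?_
  rw [← abs_neg]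
  congr 2
  simp [center]
  ring

/-- Both `x 0` and the offset from the slice centre scale linearly about `center r`. -/
lemma expand_mem_body {r : ℕ} {x : Fin (r + 3) → ℝ} {ρ : ℝ} (hρ : 0 < ρ) (h0 : |x 0| ≤ ρ)
    (h1 : dev x ≤ ρ) : center r + ρ⁻¹ • (x - center r) ∈ body r := by
  have hρ' := hρ.ne'
  constructor
  · simp only [center, Pi.add_apply, Pi.smul_apply, Pi.sub_apply, Fin.cons_zero, smul_eq_mul,
      sub_zero, zero_add, abs_mul, abs_inv, abs_of_pos hρ]
    rw [inv_mul_le_iff₀ hρ]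
    simpa using h0
  · have : dev (center r + ρ⁻¹ • (x - center r)) = ρ⁻¹ * dev x := by
      rw [dev, dev, mul_sum]
      refine sum_congr rfl fun i _ => ?_
      rw [mul_left_comm, ← abs_of_pos (inv_pos.mpr hρ), ← abs_mul, abs_of_pos (inv_pos.mpr hρ)]
      congr 2
      simp [center]
      ring
    rw [this, inv_mul_le_iff₀ hρ]
    simpa using h1

/-! ### Lattice points with midpoints in the interior -/

/-- `2 ^ (r + 2) + 2` integral points of the body, any two with their midpoint in the interior. -/
def node (r : ℕ) : Bool ⊕ (Fin (r + 2) → Bool) → Fin (r + 3) → ℤ :=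
  Sum.elim (fun s => Fin.cons (if s then 1 else -1) fun _ => if s then 0 else 1)
    (fun v => Fin.cons 0 fun i => if v i then 1 else 0)

/-- The midpoint of two nodes. -/
noncomputable def mid {r : ℕ} (a b : Bool ⊕ (Fin (r + 2) → Bool)) : Fin (r + 3) → ℝ :=
  fun i => ((node r a i : ℝ) + (node r b i : ℝ)) / 2

/-- A bound, less than `1`, for the distance of midpoints of nodes from the centre. -/
noncomputable def ratio (r : ℕ) : ℝ := 1 - 1 / (2 * ((r : ℝ) + 1))

lemma half_le_ratio (r : ℕ) : 1 / 2 ≤ ratio r := by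
  have : 1 / (2 * ((r : ℝ) + 1)) ≤ 1 / 2 := by
    apply one_div_le_one_div_of_le (by norm_num)
    linarith [(Nat.cast_nonneg r : (0 : ℝ) ≤ r)]
  unfold ratio; linarith

lemma ratio_lt_one (r : ℕ) : ratio r < 1 := by
  have : 0 < 1 / (2 * ((r : ℝ) + 1)) := by positivity
  unfold ratio; linarith

lemma dev_le_of_abs_le {r : ℕ} {x : Fin (r + 3) → ℝ} {c : ℝ}
    (h : ∀ i : Fin (r + 2), |x i.succ - (1 - x 0) / 2| ≤ c) : dev x ≤ 2 * c := by
  rw [← sum_wt r, sum_mul]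
  exact sum_le_sum fun i _ => mul_le_mul_of_nonneg_left (h i) (wt_pos r i).le

lemma mid_mem {r : ℕ} {a b : Bool ⊕ (Fin (r + 2) → Bool)} (hab : a ≠ b) :
    |mid a b 0| ≤ ratio r ∧ dev (mid a b) ≤ ratio r := by
  have hr := half_le_ratio r
  rcases a with s | v <;> rcases b with s' | v'
  · have hs : s ≠ s' := fun h => hab (by rw [h])
    refine ⟨?_, (dev_le_of_abs_le (c := 1 / 4) fun i => ?_).trans (by linarith)⟩ <;>
    cases s <;> cases s' <;> simp [mid, node] at hs ⊢ <;> linarith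
  -- The midpoint has height `±1/2`, and each other coordinate is exactly `1/4` from the slice
  -- centre.
  · refine ⟨?_, (dev_le_of_abs_le (c := 1 / 4) fun i => ?_).trans (by linarith)⟩
    · cases s <;> simp [mid, node] <;> norm_num <;> linarith
    · cases s <;> by_cases h : v' i <;> simp [mid, node, h, abs_le] <;> norm_num
  · refine ⟨?_, (dev_le_of_abs_le (c := 1 / 4) fun i => ?_).trans (by linarith)⟩
    · cases s' <;> simp [mid, node] <;> norm_num <;> linarith
    · cases s' <;> by_cases h : v i <;> simp [mid, node, h, abs_le] <;> norm_num
  · refine ⟨?_, ?_⟩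
    · simp [mid, node]; linarith
    · obtain ⟨i, hi⟩ : ∃ i, v i ≠ v' i := by
        by_contra! h
        exact hab (by rw [funext h])
      -- In a coordinate where the two vectors differ the midpoint is `1/2`, which saves half a
      -- weight, at least `1 / (2 * (r + 1))`.
      have hz : ∀ j : Fin (r + 2), (wt r j : ℝ) *
          |mid (Sum.inr v) (Sum.inr v') j.succ - (1 - mid (Sum.inr v) (Sum.inr v') 0) / 2| ≤
          (wt r j : ℝ) * (1 / 2) - if j = i then (wt r j : ℝ) * (1 / 2) else 0 := by
        intro j
        split_ifs with hj
        · subst hj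
          revert hi
          cases hv : v j <;> cases hv' : v' j <;> simp [mid, node, hv, hv']
        · rw [sub_zero]
          refine mul_le_mul_of_nonneg_left ?_ (wt_pos r j).le
          cases hv : v j <;> cases hv' : v' j <;> simp [mid, node, hv, hv', abs_le]; norm_num
      have h := sum_le_sum fun j (_ : j ∈ univ) => hz j
      rw [sum_sub_distrib, ← sum_mul, sum_wt, sum_ite_eq' univ i, if_pos (mem_univ i)] at h
      have hw := le_wt r i
      have : 1 / (2 * ((r : ℝ) + 1)) = 1 / ((r : ℝ) + 1) * (1 / 2) := by
        rw [one_div_mul_one_div, mul_comm]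
      unfold dev ratio
      linarith

lemma exists_node_pair {r : ℕ} {d : Fin (2 ^ (r + 2) + 1) → Fin (r + 3) → ℤ}
    {δ : Fin (2 ^ (r + 2) + 1) → ℤ} (h : IsDisjunction (2 ^ (r + 2) + 1) d δ) :
    ∃ a b, a ≠ b ∧ ∃ i, ∑ j, (d i j : ℝ) * mid a b j ≤ (δ i : ℝ) := by
  choose f hf using fun a => h.2 (node r a)
  -- Pigeonhole: one node more than there are terms.
  obtain ⟨a, b, hab, hfab⟩ := Fintype.exists_ne_map_eq_of_card_lt f (by simp; omega)
  refine ⟨a, b, hab, f a, ?_⟩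
  have ha : ∑ j, (d (f a) j : ℝ) * (node r a j : ℝ) ≤ (δ (f a) : ℝ) := by exact_mod_cast hf a
  have hb : ∑ j, (d (f a) j : ℝ) * (node r b j : ℝ) ≤ (δ (f a) : ℝ) := by
    rw [hfab]; exact_mod_cast hf b
  have : ∑ j, (d (f a) j : ℝ) * mid a b j = (∑ j, (d (f a) j : ℝ) * (node r a j : ℝ) +
      ∑ j, (d (f a) j : ℝ) * (node r b j : ℝ)) / 2 := by
    rw [← sum_add_distrib, sum_div]
    exact sum_congr rfl fun j _ => by simp only [mid]; ring
  linarith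

/-! ### Closures -/

lemma linVal_combo {p q : ℕ} (α : Fin p → ℚ) (β : Fin q → ℚ) (a b : ℝ) (z w : Point p q) :
    linVal α β (a • z + b • w) = a * linVal α β z + b * linVal α β w := by
  simp only [linVal, Prod.fst_add, Prod.snd_add, Prod.smul_fst, Prod.smul_snd, Pi.add_apply,
    Pi.smul_apply, smul_eq_mul, mul_add, sum_add_distrib, mul_sum]
  have h (s t u : ℝ) : s * (t * u) = t * (s * u) := by ring
  simp only [h a, h b]
  ring

lemma continuous_linVal {p q : ℕ} (α : Fin p → ℚ) (β : Fin q → ℚ) :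
    Continuous (linVal α β : Point p q → ℝ) := by
  unfold linVal; fun_prop

lemma convex_linVal_le {p q : ℕ} (α : Fin p → ℚ) (β : Fin q → ℚ) (γ : ℝ) :
    Convex ℝ {z : Point p q | linVal α β z ≤ γ} := by
  intro z hz w hw a b ha hb hab
  simp only [Set.mem_ofPred_eq, linVal_combo] at *
  calc a * linVal α β z + b * linVal α β w ≤ a * γ + b * γ := by gcongr
    _ = γ := by rw [← add_mul, hab, one_mul]

lemma convex_disjClosure {p q : ℕ} (k : ℕ) {P : Set (Point p q)} (hP : Convex ℝ P) :
    Convex ℝ (disjClosure k P) := fun _ hz _ hw _ _ ha hb hab =>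
  ⟨hP hz.1 hw.1 ha hb hab, fun α β γ h =>
    convex_linVal_le α β γ (hz.2 α β γ h) (hw.2 α β γ h) ha hb hab⟩

lemma isClosed_disjClosure {p q : ℕ} (k : ℕ) {P : Set (Point p q)} (hP : IsClosed P) :
    IsClosed (disjClosure k P) := by
  have : disjClosure k P = P ∩ ⋂ (α) (β) (γ) (_ : IsDisjunctiveCut k P α β γ),
      {z | linVal α β z ≤ γ} := by
    ext z; simp [disjClosure]
  rw [this]
  refine hP.inter ?_
  refine isClosed_iInter fun α => isClosed_iInter fun β => isClosed_iInter fun γ =>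
    isClosed_iInter fun _ => isClosed_le (continuous_linVal α β) continuous_const

lemma integerHull_subset_disjClosure {p q : ℕ} (k : ℕ) {P : Set (Point p q)} (hP : Convex ℝ P) :
    integerHull P ⊆ disjClosure k P := fun _ hz =>
  ⟨convexHull_min (fun _ h => h.1) hP hz, fun _ _ _ h => h.1.1 _ hz⟩

lemma integerHull_disjClosure {p q : ℕ} (k : ℕ) {P : Set (Point p q)} (hP : Convex ℝ P) :
    integerHull (disjClosure k P) = integerHull P :=
  Set.Subset.antisymm (convexHull_mono fun _ h => ⟨h.1.1, h.2⟩)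
    (convexHull_mono fun _ h =>
      ⟨integerHull_subset_disjClosure k hP (subset_convexHull ℝ _ h), h.2⟩)

lemma convex_iterClosure {p q : ℕ} (k : ℕ) {P : Set (Point p q)} (hP : Convex ℝ P) :
    ∀ n, Convex ℝ (iterClosure k P n)
  | 0 => hP
  | n + 1 => convex_disjClosure k (convex_iterClosure k hP n)

lemma isClosed_iterClosure {p q : ℕ} (k : ℕ) {P : Set (Point p q)} (hP : IsClosed P) :
    ∀ n, IsClosed (iterClosure k P n)
  | 0 => hP
  | n + 1 => isClosed_disjClosure k (isClosed_iterClosure k hP n)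

lemma iterClosure_subset {p q : ℕ} (k : ℕ) (P : Set (Point p q)) : ∀ n, iterClosure k P n ⊆ P
  | 0 => le_rfl
  | n + 1 => fun _ hz => iterClosure_subset k P n hz.1

lemma integerHull_iterClosure {p q : ℕ} (k : ℕ) {P : Set (Point p q)} (hP : Convex ℝ P) :
    ∀ n, integerHull (iterClosure k P n) = integerHull P
  | 0 => rfl
  | n + 1 => (integerHull_disjClosure k (convex_iterClosure k hP n)).trans
      (integerHull_iterClosure k hP n)

lemma convex_polyhedron {p q m : ℕ} (A : Matrix (Fin m) (Fin p) ℚ) (G : Matrix (Fin m) (Fin q) ℚ)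
    (b : Fin m → ℚ) : Convex ℝ (polyhedron A G b) := fun _ hz _ hw _ _ ha hb hab r =>
  convex_linVal_le (A r) (G r) (b r) (hz r) (hw r) ha hb hab

/-- If a point above the centre lies in `S`, then a lower one survives in the closure of `S`. -/
lemma center_mem_disjClosure {r q : ℕ} {S : Set (Point (r + 3) q)} (hS : Convex ℝ S)
    (hI : integerHull S = integerHull (pyramid r q)) {y : Fin q → ℝ} (hy : (center r, y) ∈ S) :
    (center r, ((1 - ratio r) / 2) • y) ∈ disjClosure (2 ^ (r + 2) + 1) S := by
  have hr := half_le_ratio r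
  have hr1 := ratio_lt_one r
  have hρ : ratio r ≠ 0 := by linarith
  have hIS : integerHull S ⊆ S := convexHull_min (fun _ h => h.1) hS
  have hbody : ∀ x ∈ body r, ((x, 0) : Point (r + 3) q) ∈ integerHull S := fun x hx => by
    rw [hI]; exact body_subset_integerHull q hx
  refine ⟨?_, ?_⟩
  · have hc : center r ∈ body r := by simp [body, dev, center]
    have := hS hy (hIS (hbody _ hc)) (a := (1 - ratio r) / 2) (b := 1 - (1 - ratio r) / 2)
      (by linarith) (by linarith) (by ring)
    convert this using 1
    refine Prod.ext ?_ (by simp)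
    simp [← add_smul]
  · rintro α β γ ⟨⟨hval, -⟩, d, δ, hd, hcut⟩
    obtain ⟨a, b, hab, i, hi⟩ := exists_node_pair hd
    obtain ⟨h0, h1⟩ := mid_mem hab
    -- This point lies on the segment from `(center r, y)` to a point of the body at height `0`.
    have hmem : (mid a b, (1 - ratio r) • y) ∈ S := by
      have := hS hy (hIS (hbody _ (expand_mem_body (by linarith) h0 h1)))
        (a := 1 - ratio r) (b := ratio r) (by linarith) (by linarith) (by ring)
      convert this using 1
      refine Prod.ext ?_ (by simp)
      funext j
      simp
      field_simp
      ring
    have hle : linVal α β (mid a b, (1 - ratio r) • y) ≤ γ := by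
      by_contra! hlt
      exact absurd (hcut _ hmem hlt i) (not_lt.mpr hi)
    have hle' := hval _ (hbody _ (reflect_mem_body (x := mid a b)
      ⟨h0.trans hr1.le, h1.trans hr1.le⟩))
    have := convex_linVal_le α β γ hle hle' (a := 1 / 2) (b := 1 / 2) (by norm_num) (by norm_num)
      (by norm_num)
    convert this using 1
    simp only [Set.mem_ofPred_eq]
    congr! 2
    refine Prod.ext ?_ ?_
    · funext j; simp; ring
    · funext j; simp; ring

end MILP

/-! ### The main theorem -/

open MILP

theorem mainTheorem3 (p q : ℕ) (hp : 3 ≤ p) (hq : 1 ≤ q) :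
    ∃ (m : ℕ) (A : Matrix (Fin m) (Fin p) ℚ) (G : Matrix (Fin m) (Fin q) ℚ) (b : Fin m → ℚ)
      (c : Fin p → ℚ) (h : Fin q → ℚ) (γ : ℝ),
      BddAbove (MILP.linVal c h '' MILP.polyhedron A G b) ∧
      IsGreatest (MILP.linVal c h '' MILP.integerHull (MILP.polyhedron A G b)) γ ∧
      ∀ n : ℕ, ∃ v : ℝ,
        IsGreatest (MILP.linVal c h ''
          MILP.iterClosure (2 ^ (p - 1) + 1) (MILP.polyhedron A G b) n) v ∧ γ < v := by
  obtain ⟨r, rfl⟩ : ∃ r, p = r + 3 := ⟨p - 3, by omega⟩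
  rw [show r + 3 - 1 = r + 2 from rfl]
  obtain ⟨m, A, G, b, hP⟩ := exists_polyhedron_eq_pyramid r q
  have hconv : Convex ℝ (pyramid r q) := hP ▸ convex_polyhedron A G b
  have hcenter : center r ∈ body r := by simp [body, dev, center]
  refine ⟨m, A, G, b, 0, 1, 0, ?_, ⟨⟨(center r, 0), ?_, by simp [linVal_zero_one]⟩, ?_⟩, fun n => ?_⟩ <;> rw [hP]
  · exact ((isCompact_pyramid r q).image (continuous_linVal 0 1)).bddAbove
  · exact body_subset_integerHull q hcenter
  · rintro _ ⟨z, hz, rfl⟩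
    refine convexHull_min ?_ (convex_linVal_le 0 1 0) hz
    rintro w ⟨hw, u, hu⟩
    rw [Set.mem_ofPred_eq, linVal_zero_one]
    exact sum_le_zero_of_integral hw u hu
  · set S := iterClosure (2 ^ (r + 2) + 1) (pyramid r q)
    have hmem : ∀ n, ∃ ε : ℝ, 0 < ε ∧ (center r, ε • Pi.single (⟨0, hq⟩ : Fin q) (1 : ℝ)) ∈ S n := by
      intro n
      induction n with
      | zero =>
        refine ⟨1, one_pos, fun j => ?_, ?_, ?_⟩
        · by_cases hj : j = ⟨0, hq⟩ <;> simp [hj]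
        · simp [center]
        · simp [dev, center]
      | succ n ih =>
        obtain ⟨ε, hε, h⟩ := ih
        refine ⟨(1 - ratio r) / 2 * ε, ?_, ?_⟩
        · have := ratio_lt_one r
          exact mul_pos (by linarith) hε
        · rw [mul_smul]
          exact center_mem_disjClosure (convex_iterClosure _ hconv n)
            (integerHull_iterClosure _ hconv n) h
    obtain ⟨ε, hε, h⟩ := hmem n
    -- Each closure is closed in a compact set, so the maximum is attained.
    have hcomp : IsCompact (S n) := (isCompact_pyramid r q).of_isClosed_subset
      (isClosed_iterClosure _ (isClosed_pyramid r q) n) (iterClosure_subset _ _ n)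
    obtain ⟨v, hv⟩ := (hcomp.image (continuous_linVal 0 1)).exists_isGreatest ⟨_, _, h, rfl⟩
    refine ⟨v, hv, lt_of_lt_of_le hε ?_⟩
    refine le_trans (le_of_eq ?_) (hv.2 ⟨_, h, rfl⟩)
    simp [linVal_zero_one, ← Finset.mul_sum]
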